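/- Let $\mathcal X$ be a non-empty set with a separable metrizable topology, equipped with its Borel $\sigma$-algebra, and let $(\mathcal Y,\ell)$ be a non-empty bounded separable metric space, equipped with its Borel $\sigma$-algebra. A (randomized) online learning rule $f_\cdot$ consists of a probability space $(R,\rho)$ of internal randomness and measurable maps $f_t : \mathcal X^{t-1}\times\mathcal Y^{t-1}\times\mathcal X\times R\to\mathcal Y$, $t\ge 1$. A process $(\mathbb X,\mathbb Y)=\{(X_t,Y_t)\}_{t\ge1}$ is a sequence of $\mathcal X\times\mathcal Y$-valued random variables on a common probability space. For measurable $A\subseteq\mathcal X$ put $$\hat\mu_{\mathbb X}(A)=\limsup_{n\to\infty}\frac1n\sum_{t=1}^n \mathbf 1_A(X_t).$$ Say that $\mathbb X$ satisfies Condition 1 if $\lim_{k\to\infty}\mathbb E[\hat\mu_{\mathbb X}(A_k)]=0$ for every sequence $A_1\supseteq A_2\supseteq\cdots$ of measurable subsets of $\mathcal X$ with $\bigcap_k A_k=\emptyset$. Then there is a single online learning rule $f_\cdot$ (depending only on $\mathcal X$ and $(\mathcal Y,\ell)$) such that for every process $(\mathbb X,\mathbb Y)$ for which $\mathbb X$ satisfies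 Condition 1 (with no restriction on $\mathbb Y$), and for every measurable $f_0:\mathcal X\to\mathcal Y$, almost surely $$\limsup_{T\to\infty}\frac1T\sum_{t=1}^T\Bigl(\ell\bigl(f_t(X_{1:(t-1)},Y_{1:(t-1)},X_t,r),Y_t\bigr)-\ell\bigl(f_0(X_t),Y_t\bigr)\Bigr)\le 0,$$ where $r\sim\rho$ is independent of $(\mathbb X,\mathbb Y)$; that is, $f_\cdot$ is strongly universally consistent for the set of all processes whose $\mathbb X$ satisfies Condition 1. -/

import Mathlib

open MeasureTheory Filter Topology

universe u v w

/-- A (possibly randomized) online learning rule. Times are indexed from `0`, so `predict t` sees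
`t` past points, `t` past responses, the current point and the learner's internal randomness,
a random element of `Seed` with distribution `law`. The prediction is jointly measurable. -/
structure OnlineLearningRule (X : Type u) (Y : Type v) [MeasurableSpace X] [MeasurableSpace Y] where
  Seed : Type
  [measurableSpaceSeed : MeasurableSpace Seed]
  law : Measure Seed
  [isProbabilityMeasure_law : IsProbabilityMeasure law]
  predict : (t : ℕ) → (Fin t → X) → (Fin t → Y) → X → Seed → Y
  measurable_predict : ∀ t : ℕ, Measurable
    (fun p : (Fin t → X) × (Fin t → Y) × X × Seed => predict t p.1 p.2.1 p.2.2.1 p.2.2.2)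

attribute [instance] OnlineLearningRule.measurableSpaceSeed
attribute [instance] OnlineLearningRule.isProbabilityMeasure_law

noncomputable section

/-- Upper long-run empirical frequency of `A` along the sequence `x`. The averages lie in `[0, 1]`,
so the real `limsup` is the usual one. -/
def upperFrequency {X : Type u} (x : ℕ → X) (A : Set X) : ℝ :=
  limsup (fun n : ℕ => (1 / (n : ℝ)) * ∑ t ∈ Finset.range n, A.indicator (fun _ => (1 : ℝ)) (x t))
    atTop

/-- `E[upperFrequency A_k] → 0` for all measurable `A_k` decreasing to the empty set. -/
def ContinuousSubmeasureCondition {X : Type u} [MeasurableSpace X] {Ω : Type w} [MeasurableSpace Ω]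
    (P : Measure Ω) (Xs : ℕ → Ω → X) : Prop :=
  ∀ A : ℕ → Set X, (∀ k, MeasurableSet (A k)) → Antitone A → (⋂ k, A k) = ∅ →
    Tendsto (fun k => ∫ ω, upperFrequency (fun t => Xs t ω) (A k) ∂P) atTop (𝓝 0)

/-- Long-run average excess loss of the rule `f` with seed `r` over the fixed predictor `f₀` on the
data sequence `(x, y)`; the loss is the metric of `Y`. For bounded `Y` the averages are bounded, so
the real `limsup` is the usual one. -/
def OnlineLearningRule.excessLoss {X : Type u} {Y : Type v} [MeasurableSpace X] [MeasurableSpace Y]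
    [MetricSpace Y] (f : OnlineLearningRule X Y) (f₀ : X → Y) (x : ℕ → X) (y : ℕ → Y)
    (r : f.Seed) : ℝ :=
  limsup (fun T : ℕ => (1 / (T : ℝ)) * ∑ t ∈ Finset.range T,
    (dist (f.predict t (fun s : Fin t => x s) (fun s : Fin t => y s) (x t) r) (y t)
      - dist (f₀ (x t)) (y t))) atTop

/-- Strong consistency of `f` for the process `(Xs, Ys)` on `(Ω, P)`: for every measurable `f₀`, the
long-run average excess loss is almost surely `≤ 0`. The product measure makes the internal
randomness of the rule independent of the data. -/
def OnlineLearningRule.StronglyConsistent {X : Type u} {Y : Type v} [MeasurableSpace X]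
    [MeasurableSpace Y] [MetricSpace Y] (f : OnlineLearningRule X Y) {Ω : Type w}
    [MeasurableSpace Ω] (P : Measure Ω) (Xs : ℕ → Ω → X) (Ys : ℕ → Ω → Y) : Prop :=
  ∀ f₀ : X → Y, Measurable f₀ →
    ∀ᵐ p ∂(P.prod f.law), f.excessLoss f₀ (fun t => Xs t p.1) (fun t => Ys t p.1) p.2 ≤ 0

end

/-! By Condition 1, `A ↦ E[upperFrequency A]` is a monotone subadditive set function that is
continuous from above at `∅`. This is enough to approximate every measurable set by members of a
countable generating algebra. Hence decision lists over that algebra, with values in a dense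
sequence of `Y`, form one countable family of predictors that is dense for every such set function
at once (`exists_dense_sequence`). By Markov's inequality, almost surely each tolerance `ε` admits a
member of the family that is `ε`-close to `f₀` off a set of frequency below `ε`
(`ae_exists_upperFrequency_lt`).

It remains to compete with countably many experts. Each expert is a pair (predictor, learning rate
`η`), and experts are sampled proportionally to rate times weight. Then the multiplicative update
preserves the total weight in expectation (`lintegral_weight_update`), so newcomers of weight `1`
bring its mean to `T` after `T` rounds. Markov and Borel–Cantelli bound all weights polynomially,
and taking logarithms bounds the average regret to each expert by `2 η D ^ 2 + o(1)`, where `D`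
bounds the diameter of `Y`. Every predictor occurs with arbitrarily small rates. -/

/-! ### Upper frequencies as a set function. -/

section Frequency

variable {X : Type u}

lemma indicator_average_nonneg (x : ℕ → X) (A : Set X) (n : ℕ) :
    0 ≤ (1 / (n : ℝ)) * ∑ t ∈ Finset.range n, A.indicator (fun _ => (1 : ℝ)) (x t) :=
  mul_nonneg (by positivity)
    (Finset.sum_nonneg fun t _ => Set.indicator_nonneg (fun _ _ => zero_le_one) _)

lemma indicator_average_le_one (x : ℕ → X) (A : Set X) (n : ℕ) :
    (1 / (n : ℝ)) * ∑ t ∈ Finset.range n, A.indicator (fun _ => (1 : ℝ)) (x t) ≤ 1 := by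
  have h : ∑ t ∈ Finset.range n, A.indicator (fun _ => (1 : ℝ)) (x t) ≤ n := by
    calc _ ≤ ∑ t ∈ Finset.range n, (1 : ℝ) :=
          Finset.sum_le_sum fun t _ => Set.indicator_le_self' (fun _ _ => zero_le_one) _
      _ = n := by simp
  rw [one_div, inv_mul_eq_div]
  exact div_le_one_of_le₀ h (by positivity)

lemma isBoundedUnder_le_indicator_average (x : ℕ → X) (A : Set X) :
    IsBoundedUnder (· ≤ ·) atTop fun n : ℕ =>
      (1 / (n : ℝ)) * ∑ t ∈ Finset.range n, A.indicator (fun _ => (1 : ℝ)) (x t) :=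
  isBoundedUnder_of ⟨1, indicator_average_le_one x A⟩

lemma isBoundedUnder_ge_indicator_average (x : ℕ → X) (A : Set X) :
    IsBoundedUnder (· ≥ ·) atTop fun n : ℕ =>
      (1 / (n : ℝ)) * ∑ t ∈ Finset.range n, A.indicator (fun _ => (1 : ℝ)) (x t) :=
  isBoundedUnder_of ⟨0, indicator_average_nonneg x A⟩

lemma upperFrequency_nonneg (x : ℕ → X) (A : Set X) : 0 ≤ upperFrequency x A :=
  le_limsup_of_frequently_le (Frequently.of_forall (indicator_average_nonneg x A))
    (isBoundedUnder_le_indicator_average x A)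

lemma upperFrequency_le_one (x : ℕ → X) (A : Set X) : upperFrequency x A ≤ 1 :=
  limsup_le_of_le (isBoundedUnder_ge_indicator_average x A).isCoboundedUnder_le
    (Eventually.of_forall (indicator_average_le_one x A))

lemma upperFrequency_mono (x : ℕ → X) {A B : Set X} (h : A ⊆ B) :
    upperFrequency x A ≤ upperFrequency x B :=
  limsup_le_limsup
    (Eventually.of_forall fun n => mul_le_mul_of_nonneg_left
      (Finset.sum_le_sum fun _ _ => Set.indicator_le_indicator_of_subset h
        (fun _ => zero_le_one) _) (by positivity))
    (isBoundedUnder_ge_indicator_average x A).isCoboundedUnder_le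
    (isBoundedUnder_le_indicator_average x B)

lemma upperFrequency_union_le (x : ℕ → X) (A B : Set X) :
    upperFrequency x (A ∪ B) ≤ upperFrequency x A + upperFrequency x B := by
  refine le_trans (limsup_le_limsup (Eventually.of_forall fun n => ?_)
    (isBoundedUnder_ge_indicator_average x _).isCoboundedUnder_le
    (isBoundedUnder_of ⟨1 + 1, fun n =>
      add_le_add (indicator_average_le_one x A n) (indicator_average_le_one x B n)⟩))
    (limsup_add_le (isBoundedUnder_ge_indicator_average x A)
      (isBoundedUnder_le_indicator_average x A)
      (isBoundedUnder_ge_indicator_average x B).isCoboundedUnder_le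
      (isBoundedUnder_le_indicator_average x B))
  rw [← mul_add, ← Finset.sum_add_distrib]
  refine mul_le_mul_of_nonneg_left (Finset.sum_le_sum fun t _ => ?_) (by positivity)
  by_cases hA : x t ∈ A <;> by_cases hB : x t ∈ B <;> simp [hA, hB]

lemma measurable_upperFrequency [MeasurableSpace X] {Ω : Type w} [MeasurableSpace Ω]
    {Xs : ℕ → Ω → X} (hX : ∀ t, Measurable (Xs t)) {A : Set X} (hA : MeasurableSet A) :
    Measurable fun ω => upperFrequency (fun t => Xs t ω) A := by
  unfold upperFrequency
  refine Measurable.limsup fun n => Measurable.const_mul ?_ _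
  exact Finset.measurable_fun_sum _ fun t _ =>
    (measurable_const.indicator hA).comp (hX t)

lemma integrable_upperFrequency [MeasurableSpace X] {Ω : Type w} [MeasurableSpace Ω]
    {P : Measure Ω} [IsFiniteMeasure P] {Xs : ℕ → Ω → X} (hX : ∀ t, Measurable (Xs t))
    {A : Set X} (hA : MeasurableSet A) :
    Integrable (fun ω => upperFrequency (fun t => Xs t ω) A) P :=
  Integrable.of_bound (measurable_upperFrequency hX hA).aestronglyMeasurable 1
    (Eventually.of_forall fun ω => by
      rw [Real.norm_of_nonneg (upperFrequency_nonneg _ _)]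
      exact upperFrequency_le_one _ _)

end Frequency

/-! ### Continuous submeasures and approximation by an algebra. -/

section Submeasure

variable {X : Type u} [MeasurableSpace X]

/-- A monotone subadditive function on measurable sets, continuous from above at `∅`. -/
structure IsContinuousSubmeasure (ν : Set X → ℝ) : Prop where
  mono : ∀ ⦃A B⦄, MeasurableSet A → MeasurableSet B → A ⊆ B → ν A ≤ ν B
  union_le : ∀ ⦃A B⦄, MeasurableSet A → MeasurableSet B → ν (A ∪ B) ≤ ν A + ν B
  tendsto_zero : ∀ A : ℕ → Set X, (∀ k, MeasurableSet (A k)) → Antitone A → (⋂ k, A k) = ∅ →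
    Tendsto (fun k => ν (A k)) atTop (𝓝 0)

lemma ContinuousSubmeasureCondition.isContinuousSubmeasure {Ω : Type w} [MeasurableSpace Ω]
    {P : Measure Ω} [IsFiniteMeasure P] {Xs : ℕ → Ω → X} (hX : ∀ t, Measurable (Xs t))
    (h : ContinuousSubmeasureCondition P Xs) :
    IsContinuousSubmeasure fun A => ∫ ω, upperFrequency (fun t => Xs t ω) A ∂P where
  mono A B hA hB hAB := integral_mono (integrable_upperFrequency hX hA)
    (integrable_upperFrequency hX hB) fun ω => upperFrequency_mono _ hAB
  union_le A B hA hB := by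
    rw [← integral_add (integrable_upperFrequency hX hA) (integrable_upperFrequency hX hB)]
    exact integral_mono (integrable_upperFrequency hX (hA.union hB))
      ((integrable_upperFrequency hX hA).add (integrable_upperFrequency hX hB))
      fun ω => upperFrequency_union_le _ _ _
  tendsto_zero := h

namespace IsContinuousSubmeasure

variable {ν : Set X → ℝ}

lemma empty (hν : IsContinuousSubmeasure ν) : ν ∅ = 0 :=
  tendsto_nhds_unique tendsto_const_nhds
    (hν.tendsto_zero (fun _ => ∅) (fun _ => MeasurableSet.empty) antitone_const
      (Set.iInter_const _))

/-- The tails decrease to `∅`. This takes the place of countable subadditivity. -/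
lemma exists_iUnion_diff_lt (hν : IsContinuousSubmeasure ν) {A : ℕ → Set X}
    (hA : ∀ i, MeasurableSet (A i)) {δ : ℝ} (hδ : 0 < δ) :
    ∃ n, ν ((⋃ i, A i) \ ⋃ i ∈ Finset.range n, A i) < δ := by
  have hlim := hν.tendsto_zero (fun n => (⋃ i, A i) \ ⋃ i ∈ Finset.range n, A i)
    (fun n => (MeasurableSet.iUnion hA).diff (Finset.measurableSet_biUnion _ fun i _ => hA i))
    (fun m n hmn => Set.sdiff_subset_sdiff_right
      (Set.biUnion_subset_biUnion_left (by simpa using hmn)))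
    (by
      ext x
      simp only [Set.mem_iInter, Set.mem_sdiff, Set.mem_iUnion, Finset.mem_range,
        Set.mem_empty_iff_false, iff_false, not_forall]
      by_cases hx : ∃ i, x ∈ A i
      · obtain ⟨i, hi⟩ := hx
        exact ⟨i + 1, fun h => h.2 ⟨i, Nat.lt_succ_self i, hi⟩⟩
      · exact ⟨0, fun h => hx h.1⟩)
  exact (hlim.eventually (gt_mem_nhds hδ)).exists

/-- A generating algebra approximates every measurable set. -/
lemma exists_symmDiff_lt (hν : IsContinuousSubmeasure ν) {𝒜 : Set (Set X)}
    (h𝒜 : IsSetAlgebra 𝒜) (hgen : ‹MeasurableSpace X› = MeasurableSpace.generateFrom 𝒜)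
    {A : Set X} (hA : MeasurableSet A) {δ : ℝ} (hδ : 0 < δ) :
    ∃ G ∈ 𝒜, ν (symmDiff A G) < δ := by
  have hmeas : ∀ G ∈ 𝒜, MeasurableSet G := fun G hG =>
    hgen ▸ MeasurableSpace.measurableSet_generateFrom hG
  induction A, hA using MeasurableSpace.induction_on_inter hgen
    (fun s hs t ht _ => h𝒜.inter_mem hs ht) generalizing δ with
  | empty => exact ⟨∅, h𝒜.empty_mem, by simpa [hν.empty] using hδ⟩
  | basic A hA => exact ⟨A, hA, by simpa [hν.empty] using hδ⟩
  | compl A hA ih =>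
    obtain ⟨G, hG, h⟩ := ih hδ
    exact ⟨Gᶜ, h𝒜.compl_mem hG, by rwa [compl_symmDiff_compl]⟩
  | iUnion A _ hA ih =>
    -- Finite unions need only subadditivity; the tail of the countable union is discarded
    -- afterwards.
    have key : ∀ (n : ℕ) (ε : ℝ), 0 < ε → ∃ G ∈ 𝒜,
        ν (symmDiff (⋃ i ∈ Finset.range n, A i) G) < ε := by
      intro n
      induction n with
      | zero => exact fun ε hε => ⟨∅, h𝒜.empty_mem, by simpa [hν.empty] using hε⟩
      | succ n ihn =>
        intro ε hε
        obtain ⟨G, hG, h⟩ := ihn (ε / 2) (half_pos hε)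
        obtain ⟨G', hG', h'⟩ := ih n (half_pos hε)
        have hU : MeasurableSet (⋃ i ∈ Finset.range n, A i) :=
          Finset.measurableSet_biUnion _ fun i _ => hA i
        have hU' : MeasurableSet (⋃ i ∈ Finset.range (n + 1), A i) :=
          Finset.measurableSet_biUnion _ fun i _ => hA i
        refine ⟨G ∪ G', h𝒜.union_mem hG hG', ?_⟩
        have h1 := hν.mono (hU'.symmDiff ((hmeas G hG).union (hmeas G' hG')))
          ((hU.symmDiff (hmeas G hG)).union ((hA n).symmDiff (hmeas G' hG'))) (by
            rw [Finset.range_add_one, Finset.set_biUnion_insert]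
            intro x
            simp only [Set.mem_symmDiff, Set.mem_union]
            tauto)
        have h2 := hν.union_le (hU.symmDiff (hmeas G hG)) ((hA n).symmDiff (hmeas G' hG'))
        linarith
    obtain ⟨n, hn⟩ := hν.exists_iUnion_diff_lt hA (half_pos hδ)
    obtain ⟨G, hG, h⟩ := key n (δ / 2) (half_pos hδ)
    refine ⟨G, hG, ?_⟩
    have hU : MeasurableSet (⋃ i ∈ Finset.range n, A i) :=
      Finset.measurableSet_biUnion _ fun i _ => hA i
    have hI := MeasurableSet.iUnion hA
    have h1 := hν.mono (hI.symmDiff (hmeas G hG))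
      ((hI.diff hU).union (hU.symmDiff (hmeas G hG))) (by
        have hsub : (⋃ i ∈ Finset.range n, A i) ⊆ ⋃ i, A i :=
          Set.iUnion₂_subset fun i _ => Set.subset_iUnion A i
        intro x
        have := @hsub x
        simp only [Set.mem_symmDiff, Set.mem_union, Set.mem_sdiff]
        tauto)
    have h2 := hν.union_le (hI.diff hU) (hU.symmDiff (hmeas G hG))
    linarith

end IsContinuousSubmeasure

end Submeasure

/-! ### A countable dense family of predictors. -/

section DecisionList

variable {X : Type u} {Y : Type v}

open scoped Classical in
/-- The function whose value at `x` is `d i` for the first pair `(G, i)` of the list with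
`x ∈ G`, and `d 0` if there is none. -/
noncomputable def decisionList (d : ℕ → Y) : List (Set X × ℕ) → X → Y
  | [], _ => d 0
  | p :: L, x => if x ∈ p.1 then d p.2 else decisionList d L x

lemma measurable_decisionList [MeasurableSpace X] [MeasurableSpace Y] (d : ℕ → Y)
    {L : List (Set X × ℕ)} (hL : ∀ p ∈ L, MeasurableSet p.1) :
    Measurable (decisionList d L) := by
  induction L with
  | nil => exact measurable_const
  | cons p L ih =>
    classical
    exact Measurable.ite (hL p (by simp)) measurable_const
      (ih fun q hq => hL q (List.mem_cons_of_mem _ hq))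

variable [MeasurableSpace X] [MetricSpace Y] [MeasurableSpace Y] [BorelSpace Y]
  [SecondCountableTopology Y]

/-- The sets where `d i` is `ε`-close to `f` cover `X`, and finitely many cover all but a small
part. Putting a pair `(G, n)` at the head of a list, with `G` approximating `A n`, makes the list
good on `A n` and spoils it only inside `symmDiff (A n) G`. -/
lemma IsContinuousSubmeasure.exists_decisionList {ν : Set X → ℝ} (hν : IsContinuousSubmeasure ν)
    {𝒜 : Set (Set X)} (h𝒜 : IsSetAlgebra 𝒜)
    (hgen : ‹MeasurableSpace X› = MeasurableSpace.generateFrom 𝒜)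
    {d : ℕ → Y} (hd : DenseRange d) {f : X → Y} (hf : Measurable f)
    {ε δ : ℝ} (hε : 0 < ε) (hδ : 0 < δ) :
    ∃ L : List (Set X × ℕ), (∀ p ∈ L, p.1 ∈ 𝒜) ∧
      ν {x | ε ≤ dist (decisionList d L x) (f x)} < δ := by
  have hmeas : ∀ G ∈ 𝒜, MeasurableSet G := fun G hG =>
    hgen ▸ MeasurableSpace.measurableSet_generateFrom hG
  set A : ℕ → Set X := fun i => {x | dist (d i) (f x) < ε} with hAdef
  have hA : ∀ i, MeasurableSet (A i) := fun i =>
    measurableSet_lt (measurable_const.dist hf) measurable_const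
  have hB : ∀ L : List (Set X × ℕ), (∀ p ∈ L, p.1 ∈ 𝒜) →
      MeasurableSet {x | ε ≤ dist (decisionList d L x) (f x)} := fun L hL =>
    measurableSet_le measurable_const
      ((measurable_decisionList d fun p hp => hmeas _ (hL p hp)).dist hf)
  have hAU : (⋃ i, A i) = Set.univ := by
    refine Set.eq_univ_of_forall fun x => Set.mem_iUnion.2 ?_
    obtain ⟨i, hi⟩ := hd.exists_dist_lt (f x) hε
    exact ⟨i, by simpa [hAdef, dist_comm] using hi⟩
  have key : ∀ (n : ℕ) (γ : ℝ), 0 < γ → ∃ L : List (Set X × ℕ), (∀ p ∈ L, p.1 ∈ 𝒜) ∧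
      ν ({x | ε ≤ dist (decisionList d L x) (f x)} ∩ ⋃ i ∈ Finset.range n, A i) < γ := by
    intro n
    induction n with
    | zero => exact fun γ hγ => ⟨[], by simp, by simpa [hν.empty] using hγ⟩
    | succ n ih =>
      intro γ hγ
      obtain ⟨L, hL, h⟩ := ih (γ / 2) (half_pos hγ)
      obtain ⟨G, hG, h'⟩ := hν.exists_symmDiff_lt h𝒜 hgen (hA n) (half_pos hγ)
      have hL' : ∀ p ∈ (G, n) :: L, p.1 ∈ 𝒜 := by
        intro p hp
        rcases List.mem_cons.1 hp with rfl | hp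
        exacts [hG, hL p hp]
      have hU : ∀ m, MeasurableSet (⋃ i ∈ Finset.range m, A i) := fun m =>
        Finset.measurableSet_biUnion _ fun i _ => hA i
      refine ⟨(G, n) :: L, hL', ?_⟩
      have h1 := hν.mono ((hB _ hL').inter (hU (n + 1)))
        (((hB _ hL).inter (hU n)).union ((hA n).symmDiff (hmeas G hG))) (by
          rw [Finset.range_add_one, Finset.set_biUnion_insert]
          rintro x ⟨hx, hxU⟩
          by_cases hxG : x ∈ G
          · have hx' : ε ≤ dist (d n) (f x) := by simpa [decisionList, hxG] using hx
            exact Or.inr (Set.mem_symmDiff.2 (Or.inr ⟨hxG, fun h => not_lt.2 hx' h⟩))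
          · by_cases hxA : x ∈ A n
            · exact Or.inr (Set.mem_symmDiff.2 (Or.inl ⟨hxA, hxG⟩))
            · have hx' : ε ≤ dist (decisionList d L x) (f x) := by
                simpa [decisionList, hxG] using hx
              exact Or.inl ⟨hx', hxU.resolve_left hxA⟩)
      have h2 := hν.union_le ((hB _ hL).inter (hU n)) ((hA n).symmDiff (hmeas G hG))
      linarith
  obtain ⟨n, hn⟩ := hν.exists_iUnion_diff_lt hA (half_pos hδ)
  obtain ⟨L, hL, h⟩ := key n (δ / 2) (half_pos hδ)
  have hU : MeasurableSet (⋃ i ∈ Finset.range n, A i) :=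
    Finset.measurableSet_biUnion _ fun i _ => hA i
  have hI := MeasurableSet.iUnion hA
  refine ⟨L, hL, ?_⟩
  have h1 := hν.mono (hB L hL) (((hB L hL).inter hU).union (hI.diff hU)) (by
    intro x hx
    by_cases hxU : x ∈ ⋃ i ∈ Finset.range n, A i
    · exact Or.inl ⟨hx, hxU⟩
    · exact Or.inr ⟨hAU ▸ Set.mem_univ x, hxU⟩)
  have h2 := hν.union_le ((hB L hL).inter hU) (hI.diff hU)
  linarith

/-- A countable family of measurable functions, dense in a sense common to all continuous
submeasures. -/
lemma exists_dense_sequence [MeasurableSpace.CountablyGenerated X] [Nonempty Y] :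
    ∃ g : ℕ → X → Y, (∀ i, Measurable (g i)) ∧
      ∀ ν : Set X → ℝ, IsContinuousSubmeasure ν → ∀ f : X → Y, Measurable f →
        ∀ ε > 0, ∀ δ > 0, ∃ i, ν {x | ε ≤ dist (g i x) (f x)} < δ := by
  set 𝒜 := generateSetAlgebra (MeasurableSpace.countableGeneratingSet X) with h𝒜def
  have h𝒜 : IsSetAlgebra 𝒜 := isSetAlgebra_generateSetAlgebra
  have hgen : ‹MeasurableSpace X› = MeasurableSpace.generateFrom 𝒜 := by
    rw [h𝒜def, generateFrom_generateSetAlgebra_eq,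
      MeasurableSpace.generateFrom_countableGeneratingSet]
  have hcount : 𝒜.Countable :=
    countable_generateSetAlgebra (MeasurableSpace.countable_countableGeneratingSet)
  have : Countable 𝒜 := hcount.to_subtype
  obtain ⟨d, hd⟩ := TopologicalSpace.exists_dense_seq Y
  obtain ⟨e, he⟩ := exists_surjective_nat (List (𝒜 × ℕ))
  set T : List (𝒜 × ℕ) → List (Set X × ℕ) := List.map fun p => (p.1.1, p.2)
  have hT : ∀ M, ∀ p ∈ T M, p.1 ∈ 𝒜 := by
    intro M p hp
    obtain ⟨q, -, rfl⟩ := List.mem_map.1 hp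
    exact q.1.2
  have hT' : ∀ L : List (Set X × ℕ), (∀ p ∈ L, p.1 ∈ 𝒜) → ∃ M, T M = L := by
    intro L hL
    refine ⟨L.attach.map fun p => (⟨p.1.1, hL p.1 p.2⟩, p.1.2), ?_⟩
    simpa [T, List.map_map, Function.comp_def] using List.attach_map_subtype_val L
  refine ⟨fun i => decisionList d (T (e i)), fun i => measurable_decisionList d fun p hp => ?_,
    fun ν hν f hf ε hε δ hδ => ?_⟩
  · exact hgen ▸ MeasurableSpace.measurableSet_generateFrom (hT _ p hp)
  · obtain ⟨L, hL, h⟩ := hν.exists_decisionList h𝒜 hgen hd hf hε hδ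
    obtain ⟨M, rfl⟩ := hT' L hL
    obtain ⟨i, rfl⟩ := he M
    exact ⟨i, h⟩

end DecisionList

/-! ### From expected to almost sure approximation. -/

section AlmostSure

variable {X : Type u} {Y : Type v} [MeasurableSpace X] [MetricSpace Y] [MeasurableSpace Y]
  [BorelSpace Y] [SecondCountableTopology Y]

lemma ae_exists_upperFrequency_lt {g : ℕ → X → Y} (hg : ∀ i, Measurable (g i))
    (hdense : ∀ ν : Set X → ℝ, IsContinuousSubmeasure ν → ∀ f : X → Y, Measurable f →
        ∀ ε > 0, ∀ δ > 0, ∃ i, ν {x | ε ≤ dist (g i x) (f x)} < δ)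
    {Ω : Type w} [MeasurableSpace Ω] {P : Measure Ω} [IsProbabilityMeasure P]
    {Xs : ℕ → Ω → X} (hX : ∀ t, Measurable (Xs t)) (h : ContinuousSubmeasureCondition P Xs)
    {f : X → Y} (hf : Measurable f) {ε : ℝ} (hε : 0 < ε) :
    ∀ᵐ ω ∂P, ∃ i, upperFrequency (fun t => Xs t ω) {x | ε ≤ dist (g i x) (f x)} < ε := by
  have hS : ∀ i, MeasurableSet {x | ε ≤ dist (g i x) (f x)} := fun i =>
    measurableSet_le measurable_const ((hg i).dist hf)
  rw [ae_iff, ← nonpos_iff_eq_zero]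
  refine ENNReal.le_of_forall_pos_le_add fun δ hδ _ => ?_
  -- The index depends on `δ`, but the event that all indices fail does not; Markov at level `ε`
  -- turns `ε * δ` into `δ`.
  obtain ⟨i, hi⟩ := hdense _ (h.isContinuousSubmeasure hX) f hf ε hε (ε * δ) (by positivity)
  have hM := mul_meas_ge_le_integral_of_nonneg
    (Eventually.of_forall fun ω => upperFrequency_nonneg (fun t => Xs t ω) _)
    (integrable_upperFrequency (P := P) hX (hS i)) ε
  have hle : P.real {ω | ε ≤ upperFrequency (fun t => Xs t ω)
      {x | ε ≤ dist (g i x) (f x)}} ≤ δ :=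
    le_of_mul_le_mul_left (hM.trans hi.le) hε
  calc P {ω | ¬ ∃ i, upperFrequency (fun t => Xs t ω) {x | ε ≤ dist (g i x) (f x)} < ε}
      ≤ P {ω | ε ≤ upperFrequency (fun t => Xs t ω) {x | ε ≤ dist (g i x) (f x)}} :=
        measure_mono fun ω hω => not_lt.1 fun hlt => hω ⟨i, hlt⟩
    _ ≤ 0 + δ := by
        rw [zero_add, ← ENNReal.ofReal_coe_nnreal]
        exact (ENNReal.le_ofReal_iff_toReal_le (measure_ne_top _ _) δ.2).2 hle

end AlmostSure

/-! ### Sampling an index with a uniform seed. -/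

section Sampling

/-- The index in `{0, …, t}` selected by `u ∈ (0, 1]` when index `j` has probability
proportional to `a j`. -/
noncomputable def sampleIndex (a : ℕ → ℝ) (t : ℕ) (u : ℝ) : ℕ :=
  ((Finset.range t).filter fun k =>
    ∑ j ∈ Finset.range (k + 1), a j < u * ∑ j ∈ Finset.range (t + 1), a j).card

lemma sampleIndex_le (a : ℕ → ℝ) (t : ℕ) (u : ℝ) : sampleIndex a t u ≤ t :=
  (Finset.card_filter_le _ _).trans (Finset.card_range t).le

lemma measurable_sampleIndex (t : ℕ) :
    Measurable fun p : (ℕ → ℝ) × ℝ => sampleIndex p.1 t p.2 := by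
  simp only [sampleIndex, Finset.card_filter]
  refine Finset.measurable_fun_sum _ fun k _ => ?_
  refine Measurable.ite (measurableSet_lt ?_ ?_) measurable_const measurable_const <;> fun_prop

lemma measurable_sampleIndex_comp (t : ℕ) {S : Type*} [MeasurableSpace S] {a : S → ℕ → ℝ}
    (ha : Measurable a) {u : S → ℝ} (hu : Measurable u) :
    Measurable fun p => sampleIndex (a p) t (u p) := by
  have h := (measurable_sampleIndex t).comp (ha.prodMk hu)
  exact h

lemma sampleIndex_eq {a : ℕ → ℝ} (ha : ∀ j, 0 ≤ a j) {t n : ℕ} (hn : n ≤ t) {u : ℝ}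
    (h₁ : ∑ j ∈ Finset.range n, a j < u * ∑ j ∈ Finset.range (t + 1), a j)
    (h₂ : u * ∑ j ∈ Finset.range (t + 1), a j ≤ ∑ j ∈ Finset.range (n + 1), a j) :
    sampleIndex a t u = n := by
  have hmono : Monotone fun m => ∑ j ∈ Finset.range m, a j := fun m m' hm =>
    Finset.sum_le_sum_of_subset_of_nonneg (by simpa using hm) fun j _ _ => ha j
  have : ((Finset.range t).filter fun k =>
      ∑ j ∈ Finset.range (k + 1), a j < u * ∑ j ∈ Finset.range (t + 1), a j) =
      Finset.range n := by
    ext k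
    simp only [Finset.mem_filter, Finset.mem_range]
    constructor
    · rintro ⟨-, hk⟩
      by_contra hnk
      exact absurd (h₂.trans (hmono (by omega : n + 1 ≤ k + 1))) (not_le.2 hk)
    · intro hk
      exact ⟨by omega, (hmono (by omega : k + 1 ≤ n)).trans_lt h₁⟩
  rw [sampleIndex, this, Finset.card_range]

lemma measurable_comp_sampleIndex (a : ℕ → ℝ) (t : ℕ) (h : ℕ → ℝ) :
    Measurable fun u => h (sampleIndex a t u) :=
  (measurable_of_countable h).comp
    (measurable_sampleIndex_comp t measurable_const measurable_id)

lemma integrable_comp_sampleIndex (a : ℕ → ℝ) (t : ℕ) (h : ℕ → ℝ) {μ : Measure ℝ}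
    [IsFiniteMeasure μ] : Integrable (fun u => h (sampleIndex a t u)) μ := by
  refine Integrable.of_bound (measurable_comp_sampleIndex a t h).aestronglyMeasurable
    (∑ n ∈ Finset.range (t + 1), ‖h n‖) (Eventually.of_forall fun u => ?_)
  exact Finset.single_le_sum (f := fun n => ‖h n‖) (fun _ _ => norm_nonneg _)
    (Finset.mem_range.2 (Nat.lt_succ_of_le (sampleIndex_le a t u)))

/-- The normalized partial sums cut `(0, 1]` into half-open intervals on which the index is
constant. -/
lemma integral_comp_sampleIndex {a : ℕ → ℝ} (ha : ∀ j, 0 ≤ a j) (t : ℕ)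
    (hS : 0 < ∑ j ∈ Finset.range (t + 1), a j) (h : ℕ → ℝ) :
    ∫ u in (0 : ℝ)..1, h (sampleIndex a t u) =
      ∑ n ∈ Finset.range (t + 1), a n / (∑ j ∈ Finset.range (t + 1), a j) * h n := by
  set S := ∑ j ∈ Finset.range (t + 1), a j
  set c : ℕ → ℝ := fun n => (∑ j ∈ Finset.range n, a j) / S with hc
  have h0 : c 0 = 0 := by simp [hc]
  have h1 : c (t + 1) = 1 := div_self hS.ne'
  rw [← h0, ← h1, ← intervalIntegral.sum_integral_adjacent_intervals fun k _ => ?_]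
  · refine Finset.sum_congr rfl fun n hn => ?_
    have hdiff : c (n + 1) - c n = a n / S := by
      simp only [hc, Finset.sum_range_succ]
      ring
    have hle : c n ≤ c (n + 1) := sub_nonneg.1 (hdiff ▸ div_nonneg (ha n) hS.le)
    have hcongr : ∫ u in c n..c (n + 1), h (sampleIndex a t u) =
        ∫ u in c n..c (n + 1), h n := by
      refine intervalIntegral.integral_congr_ae (Eventually.of_forall fun u hu => ?_)
      rw [Set.uIoc_of_le hle] at hu
      rw [sampleIndex_eq ha (by simpa [Nat.lt_succ_iff] using hn)
        ((div_lt_iff₀ hS).1 hu.1) ((le_div_iff₀ hS).1 hu.2)]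
    rw [hcongr, intervalIntegral.integral_const, hdiff, smul_eq_mul]
  · exact ⟨integrable_comp_sampleIndex a t h, integrable_comp_sampleIndex a t h⟩

/-- The uniform distribution on `(0, 1]`. -/
noncomputable def uniformLaw : Measure ℝ := volume.restrict (Set.Ioc 0 1)

instance : IsProbabilityMeasure uniformLaw := ⟨by simp [uniformLaw]⟩

/-- If experts with weights `v` are sampled proportionally to `η * v`, then the multiplicative
update by the factors `1 + η k * (ℓ n - ℓ k)`, where `n` is the sampled expert, preserves the
total weight in expectation. -/
lemma lintegral_weight_update {v η ℓ : ℕ → ℝ} (hv : ∀ k, 0 < v k) (hη : ∀ k, 0 < η k)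
    (t : ℕ) (hℓ : ∀ n k, 0 ≤ 1 + η k * (ℓ n - ℓ k)) :
    ∫⁻ u, ENNReal.ofReal (∑ k ∈ Finset.range (t + 1),
      v k * (1 + η k * (ℓ (sampleIndex (fun j => η j * v j) t u) - ℓ k))) ∂uniformLaw =
    ENNReal.ofReal (∑ k ∈ Finset.range (t + 1), v k) := by
  set a : ℕ → ℝ := fun j => η j * v j with ha
  have hapos : ∀ j, 0 < a j := fun j => mul_pos (hη j) (hv j)
  have hS : 0 < ∑ j ∈ Finset.range (t + 1), a j :=
    Finset.sum_pos (fun j _ => hapos j) (by simp)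
  set h : ℕ → ℝ := fun n => ∑ k ∈ Finset.range (t + 1), v k * (1 + η k * (ℓ n - ℓ k)) with hh
  -- Since `a k = η k * v k`, the correction is the total of `a` times the gap between `ℓ n` and the
  -- `a`-weighted mean of `ℓ`, so it averages to zero under sampling proportional to `a`.
  have hh' : ∀ n, h n = ∑ k ∈ Finset.range (t + 1), v k +
      ((∑ k ∈ Finset.range (t + 1), a k) * ℓ n - ∑ k ∈ Finset.range (t + 1), a k * ℓ k) := by
    intro n
    rw [hh, Finset.sum_mul, ← Finset.sum_sub_distrib, ← Finset.sum_add_distrib]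
    exact Finset.sum_congr rfl fun k _ => by simp only [ha]; ring
  have hnn : ∀ n, 0 ≤ h n := fun n => Finset.sum_nonneg fun k _ => mul_nonneg (hv k).le (hℓ n k)
  change ∫⁻ u, ENNReal.ofReal (h (sampleIndex a t u)) ∂uniformLaw = _
  rw [← ofReal_integral_eq_lintegral_ofReal (integrable_comp_sampleIndex a t h)
    (Eventually.of_forall fun u => hnn _), uniformLaw,
    ← intervalIntegral.integral_of_le zero_le_one,
    integral_comp_sampleIndex (fun j => (hapos j).le) t hS]
  congr 1
  set S := ∑ j ∈ Finset.range (t + 1), a j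
  calc ∑ n ∈ Finset.range (t + 1), a n / S * h n
      = ∑ n ∈ Finset.range (t + 1), (a n * ((∑ k ∈ Finset.range (t + 1), v k -
          ∑ k ∈ Finset.range (t + 1), a k * ℓ k) / S) + a n * ℓ n) :=
        Finset.sum_congr rfl fun n _ => by rw [hh']; field_simp; ring
    _ = S * ((∑ k ∈ Finset.range (t + 1), v k -
          ∑ k ∈ Finset.range (t + 1), a k * ℓ k) / S) + ∑ n ∈ Finset.range (t + 1), a n * ℓ n := by
        rw [Finset.sum_add_distrib, Finset.sum_mul]
    _ = _ := by field_simp; ring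

/-- The law of a sequence of independent uniform random variables. -/
noncomputable def seedLaw : Measure (ℕ → ℝ) := Measure.infinitePi fun _ => uniformLaw

instance : IsProbabilityMeasure seedLaw :=
  inferInstanceAs (IsProbabilityMeasure (Measure.infinitePi fun _ => uniformLaw))

/-- A function of the first `t` coordinates is independent of the coordinate `t`. -/
lemma lintegral_seedLaw {β : Type*} [MeasurableSpace β] {V : (ℕ → ℝ) → β} (hV : Measurable V)
    {t : ℕ} (hloc : ∀ r r' : ℕ → ℝ, (∀ s < t, r s = r' s) → V r = V r')
    {F : β × ℝ → ENNReal} (hF : Measurable F) :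
    ∫⁻ r, F (V r, r t) ∂seedLaw = ∫⁻ r, ∫⁻ u, F (V r, u) ∂uniformLaw ∂seedLaw := by
  have hind : ProbabilityTheory.iIndepFun (fun i (r : ℕ → ℝ) => r i) seedLaw :=
    ProbabilityTheory.iIndepFun_infinitePi (X := fun _ z => z) fun _ => measurable_id
  have hpair := hind.indepFun_finset (Finset.range t) {t} (by simp) fun i => measurable_pi_apply i
  -- Padding with zeros exhibits `V` as a measurable function of the first `t` coordinates alone.
  set ext : (Finset.range t → ℝ) → ℕ → ℝ := fun z s =>
    if h : s ∈ Finset.range t then z ⟨s, h⟩ else 0 with hext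
  have hextm : Measurable ext := by
    refine measurable_pi_lambda _ fun s => ?_
    by_cases h : s ∈ Finset.range t
    · simp only [hext, dif_pos h]
      fun_prop
    · simp only [hext, dif_neg h]
      fun_prop
  have hVind : ProbabilityTheory.IndepFun V (fun r => r t) seedLaw := by
    have h := hpair.comp (hV.comp hextm)
      (measurable_pi_apply (⟨t, Finset.mem_singleton_self t⟩ : ({t} : Finset ℕ)))
    have hVeq : (V ∘ ext) ∘ (fun (r : ℕ → ℝ) (i : Finset.range t) => r i) = V := by
      funext r
      exact hloc _ _ fun s hs => by simp [hext, hs]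
    rw [hVeq] at h
    exact h
  have hmap := hVind.map_prod_eq_prod_map_map hV.aemeasurable
    (measurable_pi_apply t).aemeasurable
  have hev : seedLaw.map (fun r => r t) = uniformLaw := Measure.infinitePi_map_eval _ t
  rw [hev] at hmap
  rw [← lintegral_map (f := F) (g := fun r : ℕ → ℝ => (V r, r t)) hF
    (hV.prodMk (measurable_pi_apply t)), hmap,
    lintegral_prod _ hF.aemeasurable, lintegral_map hF.lintegral_prod_right' hV]

end Sampling

/-! ### Randomized multiplicative weights with a separate rate for each expert. -/

section Hedge

variable {X : Type u} {Y : Type v} [MetricSpace Y]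

/-- The weights of the experts `g` with learning rates `η` after `t` rounds. Expert `k` takes part
from round `k` on; its weight is multiplied in each round by `1 + η k * ρ`, where `ρ` is the loss
of the learner minus the loss of the expert. -/
noncomputable def expertWeight (g : ℕ → X → Y) (η : ℕ → ℝ) :
    ℕ → (ℕ → X) → (ℕ → Y) → (ℕ → ℝ) → ℕ → ℝ
  | 0, _, _, _, _ => 1
  | t + 1, x, y, r, k => expertWeight g η t x y r k * if k ≤ t then
      1 + η k * (dist (g (sampleIndex (fun j => η j * expertWeight g η t x y r j) t (r t)) (x t))
        (y t) - dist (g k (x t)) (y t)) else 1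

/-- The prediction in round `t`: the advice of an expert sampled among the first `t + 1`
proportionally to learning rate times weight. -/
noncomputable def expertPlay (g : ℕ → X → Y) (η : ℕ → ℝ) (t : ℕ) (x : ℕ → X) (y : ℕ → Y)
    (r : ℕ → ℝ) : Y :=
  g (sampleIndex (fun j => η j * expertWeight g η t x y r j) t (r t)) (x t)

variable {g : ℕ → X → Y} {η : ℕ → ℝ}

lemma expertWeight_succ (t : ℕ) (x : ℕ → X) (y : ℕ → Y) (r : ℕ → ℝ) (k : ℕ) :
    expertWeight g η (t + 1) x y r k = expertWeight g η t x y r k * if k ≤ t then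
      1 + η k * (dist (expertPlay g η t x y r) (y t) - dist (g k (x t)) (y t)) else 1 := rfl

lemma expertWeight_congr {t : ℕ} {x x' : ℕ → X} {y y' : ℕ → Y} {r r' : ℕ → ℝ}
    (hx : ∀ s < t, x s = x' s) (hy : ∀ s < t, y s = y' s) (hr : ∀ s < t, r s = r' s) :
    expertWeight g η t x y r = expertWeight g η t x' y' r' := by
  induction t with
  | zero => rfl
  | succ t ih =>
    have ih := ih (fun s hs => hx s (by omega)) (fun s hs => hy s (by omega))
      (fun s hs => hr s (by omega))
    funext k
    simp only [expertWeight, ih, hx t (by omega), hy t (by omega), hr t (by omega)]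

lemma expertPlay_congr {t : ℕ} {x x' : ℕ → X} {y y' : ℕ → Y} {r : ℕ → ℝ}
    (hx : ∀ s ≤ t, x s = x' s) (hy : ∀ s < t, y s = y' s) :
    expertPlay g η t x y r = expertPlay g η t x' y' r := by
  simp only [expertPlay, expertWeight_congr (fun s hs => hx s (le_of_lt hs)) hy fun _ _ => rfl,
    hx t le_rfl]

lemma expertWeight_of_le {t k : ℕ} (h : t ≤ k) (x : ℕ → X) (y : ℕ → Y) (r : ℕ → ℝ) :
    expertWeight g η t x y r k = 1 := by
  induction t with
  | zero => rfl
  | succ t ih => rw [expertWeight_succ, ih (by omega), if_neg (by omega), one_mul]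

section Measurability

variable [MeasurableSpace X] [MeasurableSpace Y]

lemma measurable_expertPlay_of_weight (hg : ∀ i, Measurable (g i)) {t : ℕ}
    (h : Measurable fun q : (ℕ → X) × (ℕ → Y) × (ℕ → ℝ) =>
      expertWeight g η t q.1 q.2.1 q.2.2) :
    Measurable fun q : (ℕ → X) × (ℕ → Y) × (ℕ → ℝ) => expertPlay g η t q.1 q.2.1 q.2.2 := by
  have hG : Measurable fun p : ℕ × X => g p.1 p.2 := measurable_from_prod_countable_right hg
  refine hG.comp (Measurable.prodMk (measurable_sampleIndex_comp t ?_ ?_) ?_)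
  · exact measurable_pi_lambda _ fun j => ((measurable_pi_apply j).comp h).const_mul _
  · fun_prop
  · fun_prop

variable [BorelSpace Y] [SecondCountableTopology Y]

lemma measurable_expertWeight (hg : ∀ i, Measurable (g i)) (t : ℕ) :
    Measurable fun q : (ℕ → X) × (ℕ → Y) × (ℕ → ℝ) =>
      expertWeight g η t q.1 q.2.1 q.2.2 := by
  induction t with
  | zero => exact measurable_const
  | succ t ih =>
    refine measurable_pi_lambda _ fun k => ?_
    simp only [expertWeight_succ]
    refine ((measurable_pi_apply k).comp ih).mul ?_
    have hy : Measurable fun q : (ℕ → X) × (ℕ → Y) × (ℕ → ℝ) => q.2.1 t := by fun_prop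
    have hx : Measurable fun q : (ℕ → X) × (ℕ → Y) × (ℕ → ℝ) => q.1 t := by fun_prop
    split_ifs
    · exact ((((measurable_expertPlay_of_weight hg ih).dist hy).sub
        (((hg k).comp hx).dist hy)).const_mul _).const_add _
    · exact measurable_const

lemma measurable_expertWeight_comp (hg : ∀ i, Measurable (g i)) (t : ℕ) {S : Type*}
    [MeasurableSpace S] {a : S → ℕ → X} (ha : Measurable a) {b : S → ℕ → Y} (hb : Measurable b)
    {c : S → ℕ → ℝ} (hc : Measurable c) :
    Measurable fun p => expertWeight g η t (a p) (b p) (c p) := by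
  have h := (measurable_expertWeight (η := η) hg t).comp (ha.prodMk (hb.prodMk hc))
  exact h

lemma measurable_expertPlay_comp (hg : ∀ i, Measurable (g i)) (t : ℕ) {S : Type*}
    [MeasurableSpace S] {a : S → ℕ → X} (ha : Measurable a) {b : S → ℕ → Y} (hb : Measurable b)
    {c : S → ℕ → ℝ} (hc : Measurable c) :
    Measurable fun p => expertPlay g η t (a p) (b p) (c p) := by
  have h := (measurable_expertPlay_of_weight hg (measurable_expertWeight (η := η) hg t)).comp
    (ha.prodMk (hb.prodMk hc))
  exact h

end Measurability

section Bounds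

variable {D : ℝ}

lemma abs_dist_sub_dist_le (hD : ∀ a b : Y, dist a b ≤ D) (a b c : Y) : |dist a c - dist b c| ≤ D :=
  (abs_dist_sub_le a b c).trans (hD a b)

/-- Keeps every update factor at least `1 / 2` and within the range of the logarithm estimate below.
-/
lemma abs_rate_mul_le (hD : ∀ a b : Y, dist a b ≤ D) (hη : ∀ k, 0 < η k)
    (hηD : ∀ k, η k * D ≤ 1 / 2) (k : ℕ) (a b c : Y) : |η k * (dist a c - dist b c)| ≤ 1 / 2 := by
  rw [abs_mul, abs_of_pos (hη k)]
  exact (mul_le_mul_of_nonneg_left (abs_dist_sub_dist_le hD a b c) (hη k).le).trans (hηD k)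

lemma expertWeight_pos (hD : ∀ a b : Y, dist a b ≤ D) (hη : ∀ k, 0 < η k)
    (hηD : ∀ k, η k * D ≤ 1 / 2) (t : ℕ) (x : ℕ → X) (y : ℕ → Y) (r : ℕ → ℝ) (k : ℕ) :
    0 < expertWeight g η t x y r k := by
  induction t with
  | zero => exact one_pos
  | succ t ih =>
    rw [expertWeight_succ]
    refine mul_pos ih ?_
    split_ifs
    · have := (abs_le.1 (abs_rate_mul_le hD hη hηD k (expertPlay g η t x y r) (g k (x t)) (y t))).1
      linarith
    · exact one_pos

/-- Given the seeds before round `t`, the update preserves the mean total weight of experts `0, …,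
t`; expert `t`, entering with weight `1`, accounts for the increment. -/
lemma lintegral_sum_expertWeight (hD : ∀ a b : Y, dist a b ≤ D) (hη : ∀ k, 0 < η k)
    (hηD : ∀ k, η k * D ≤ 1 / 2) [MeasurableSpace X] [MeasurableSpace Y] [BorelSpace Y]
    [SecondCountableTopology Y] (hg : ∀ i, Measurable (g i)) (t : ℕ) (x : ℕ → X) (y : ℕ → Y) :
    ∫⁻ r, ENNReal.ofReal (∑ k ∈ Finset.range t, expertWeight g η t x y r k) ∂seedLaw = t := by
  have hWm : ∀ t, Measurable fun r => expertWeight g η t x y r := fun t =>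
    measurable_expertWeight_comp hg t measurable_const measurable_const measurable_id
  induction t with
  | zero => simp
  | succ t ih =>
    set F : (ℕ → ℝ) × ℝ → ENNReal := fun p => ENNReal.ofReal (∑ k ∈ Finset.range (t + 1),
      p.1 k * (1 + η k * (dist (g (sampleIndex (fun j => η j * p.1 j) t p.2) (x t)) (y t) -
        dist (g k (x t)) (y t)))) with hF
    have hFm : Measurable F := by
      have h1 : Measurable fun p : (ℕ → ℝ) × ℝ =>
          dist (g (sampleIndex (fun j => η j * p.1 j) t p.2) (x t)) (y t) := by
        refine (measurable_of_countable fun n => dist (g n (x t)) (y t)).comp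
          (measurable_sampleIndex_comp t ?_ measurable_snd)
        fun_prop
      refine ENNReal.measurable_ofReal.comp (Finset.measurable_fun_sum _ fun k _ => ?_)
      exact ((measurable_pi_apply k).comp measurable_fst).mul
        (((h1.sub_const _).const_mul _).const_add _)
    calc ∫⁻ r, ENNReal.ofReal (∑ k ∈ Finset.range (t + 1), expertWeight g η (t + 1) x y r k)
          ∂seedLaw = ∫⁻ r, F (expertWeight g η t x y r, r t) ∂seedLaw := by
          refine lintegral_congr fun r => ?_
          simp only [hF]
          congr 1
          refine Finset.sum_congr rfl fun k hk => ?_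
          rw [expertWeight_succ, if_pos (by simpa [Nat.lt_succ_iff] using hk), expertPlay]
      _ = ∫⁻ r, ∫⁻ u, F (expertWeight g η t x y r, u) ∂uniformLaw ∂seedLaw :=
          lintegral_seedLaw (hWm t)
            (fun r r' h => expertWeight_congr (fun _ _ => rfl) (fun _ _ => rfl) h) hFm
      _ = ∫⁻ r, (ENNReal.ofReal (∑ k ∈ Finset.range t, expertWeight g η t x y r k) + 1)
          ∂seedLaw := by
          refine lintegral_congr fun r => ?_
          have hpos := expertWeight_pos (g := g) hD hη hηD t x y r
          simp only [hF]
          rw [lintegral_weight_update (ℓ := fun n => dist (g n (x t)) (y t)) hpos hη t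
            fun n k => by
              have := (abs_le.1 (abs_rate_mul_le hD hη hηD k (g n (x t)) (g k (x t)) (y t))).1
              linarith,
            Finset.sum_range_succ, expertWeight_of_le le_rfl,
            ENNReal.ofReal_add (Finset.sum_nonneg fun k _ => (hpos k).le) zero_le_one,
            ENNReal.ofReal_one]
      _ = (t + 1 : ℕ) := by
          rw [lintegral_add_right _ measurable_const, ih]
          simp

/-- A total weight of mean `T` exceeds `(T + 1) ^ 3` with probability at most `1 / (T + 1) ^ 2`,
which is summable, so Borel–Cantelli applies. -/
lemma ae_eventually_expertWeight_le (hD : ∀ a b : Y, dist a b ≤ D) (hη : ∀ k, 0 < η k)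
    (hηD : ∀ k, η k * D ≤ 1 / 2) [MeasurableSpace X] [MeasurableSpace Y] [BorelSpace Y]
    [SecondCountableTopology Y] (hg : ∀ i, Measurable (g i)) (x : ℕ → X) (y : ℕ → Y) :
    ∀ᵐ r ∂seedLaw, ∀ k, ∀ᶠ T : ℕ in atTop,
      expertWeight g η T x y r k ≤ ((T : ℝ) + 1) ^ 3 := by
  have hWm : ∀ t, Measurable fun r => ENNReal.ofReal
      (∑ k ∈ Finset.range t, expertWeight g η t x y r k) := fun t =>
    ENNReal.measurable_ofReal.comp (Finset.measurable_fun_sum _ fun k _ =>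
      (measurable_pi_apply k).comp
        (measurable_expertWeight_comp hg t measurable_const measurable_const measurable_id))
  have hmarkov : ∀ T : ℕ, seedLaw {r | ENNReal.ofReal (((T : ℝ) + 1) ^ 3) ≤ ENNReal.ofReal
      (∑ k ∈ Finset.range T, expertWeight g η T x y r k)} ≤
      ENNReal.ofReal (1 / ((T : ℝ) + 1) ^ 2) := by
    intro T
    have hpos : (0 : ℝ) < ((T : ℝ) + 1) ^ 3 := by positivity
    refine (meas_ge_le_lintegral_div (hWm T).aemeasurable
      (by simpa using hpos) ENNReal.ofReal_ne_top).trans ?_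
    rw [lintegral_sum_expertWeight hD hη hηD hg, ← ENNReal.ofReal_natCast,
      ← ENNReal.ofReal_div_of_pos hpos]
    refine ENNReal.ofReal_le_ofReal ?_
    rw [div_le_div_iff₀ hpos (by positivity)]
    have : (0 : ℝ) ≤ ((T : ℝ) + 1) ^ 2 := by positivity
    nlinarith
  have hsum : ∑' T : ℕ, seedLaw {r | ENNReal.ofReal (((T : ℝ) + 1) ^ 3) ≤ ENNReal.ofReal
      (∑ k ∈ Finset.range T, expertWeight g η T x y r k)} ≠ ⊤ := by
    refine ne_top_of_le_ne_top ?_ (ENNReal.tsum_le_tsum hmarkov)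
    have hs : Summable fun T : ℕ => 1 / ((T : ℝ) + 1) ^ 2 := by
      have := (summable_nat_add_iff 1).2 (Real.summable_one_div_nat_pow.2 one_lt_two)
      simpa using this
    exact hs.tsum_ofReal_ne_top
  filter_upwards [ae_eventually_notMem hsum] with r hr k
  filter_upwards [hr, eventually_gt_atTop k] with T hT hk
  have hT' := lt_of_not_ge hT
  rw [ENNReal.ofReal_lt_ofReal_iff (by positivity)] at hT'
  exact (Finset.single_le_sum (f := fun k => expertWeight g η T x y r k)
    (fun j _ => (expertWeight_pos hD hη hηD T x y r j).le)
    (Finset.mem_range.2 hk)).trans hT'.le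

/-- The inequality `z - 2 * z ^ 2 ≤ log (1 + z)` for `|z| ≤ 1 / 2` is summed over the rounds in
which expert `k` takes part. The `min T k` earlier rounds cost at most `η k * D` each. -/
lemma regret_le_log_expertWeight (hD : ∀ a b : Y, dist a b ≤ D) (hη : ∀ k, 0 < η k)
    (hηD : ∀ k, η k * D ≤ 1 / 2) (T : ℕ) (x : ℕ → X) (y : ℕ → Y) (r : ℕ → ℝ) (k : ℕ) :
    η k * ∑ t ∈ Finset.range T,
        (dist (expertPlay g η t x y r) (y t) - dist (g k (x t)) (y t)) ≤
      Real.log (expertWeight g η T x y r k) + T * (2 * (η k * D) ^ 2)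
        + (min T k : ℕ) * (η k * D) := by
  induction T with
  | zero => simp [expertWeight]
  | succ T ih =>
    have hpos := expertWeight_pos (g := g) hD hη hηD T x y r k
    have habs := abs_dist_sub_dist_le hD (expertPlay g η T x y r) (g k (x T)) (y T)
    have hz := abs_rate_mul_le hD hη hηD k (expertPlay g η T x y r) (g k (x T)) (y T)
    set ρ := dist (expertPlay g η T x y r) (y T) - dist (g k (x T)) (y T)
    have hzD : |η k * ρ| ≤ η k * D := by
      rw [abs_mul, abs_of_pos (hη k)]
      exact mul_le_mul_of_nonneg_left habs (hη k).le
    rw [Finset.sum_range_succ, mul_add, expertWeight_succ]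
    set z := η k * ρ
    rw [Nat.cast_succ]
    split_ifs with hk
    · have hz' := abs_le.1 hz
      have h1 : z - 2 * z ^ 2 ≤ Real.log (1 + z) := by
        refine le_trans ?_ (Real.one_sub_inv_le_log_of_pos (by linarith : 0 < 1 + z))
        have hne : 0 < 1 + z := by linarith
        rw [← sub_nonneg]
        have : 1 - (1 + z)⁻¹ - (z - 2 * z ^ 2) = z ^ 2 * (1 + 2 * z) / (1 + z) := by
          field_simp
          ring
        rw [this]
        exact div_nonneg (mul_nonneg (sq_nonneg _) (by linarith)) hne.le
      have h2 : z ^ 2 ≤ (η k * D) ^ 2 := sq_le_sq' (by linarith [(abs_le.1 hzD).1]) (abs_le.1 hzD).2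
      rw [Real.log_mul hpos.ne' (by linarith)]
      have h3 : min (T + 1) k = min T k := by omega
      rw [h3]
      linarith
    · have h3 : min (T + 1) k = min T k + 1 := by omega
      rw [h3, mul_one, Nat.cast_succ]
      have := (abs_le.1 hzD).2
      linarith [sq_nonneg (η k * D)]

lemma eventually_average_regret_le (hD : ∀ a b : Y, dist a b ≤ D) (hη : ∀ k, 0 < η k)
    (hηD : ∀ k, η k * D ≤ 1 / 2) {x : ℕ → X} {y : ℕ → Y} {r : ℕ → ℝ} {k : ℕ}
    (h : ∀ᶠ T : ℕ in atTop, expertWeight g η T x y r k ≤ ((T : ℝ) + 1) ^ 3)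
    {ε : ℝ} (hε : 0 < ε) :
    ∀ᶠ T : ℕ in atTop, (1 / (T : ℝ)) * ∑ t ∈ Finset.range T,
      (dist (expertPlay g η t x y r) (y t) - dist (g k (x t)) (y t)) ≤
        2 * η k * D ^ 2 + ε := by
  have hD0 : 0 ≤ D := dist_nonneg.trans (hD (y 0) (y 0))
  -- The log-weight is at most three such logarithms and `T + 1 ≤ 2 * T`, so `12` leaves `ε / 2` per
  -- round; the late entry of expert `k` uses the other half.
  have hlog : ∀ᶠ T : ℕ in atTop, Real.log ((T : ℝ) + 1) ≤ ε * η k / 12 * ((T : ℝ) + 1) := by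
    have h1 := Real.isLittleO_log_id_atTop.bound (by have := hη k; positivity : 0 < ε * η k / 12)
    have h2 : Tendsto (fun T : ℕ => (T : ℝ) + 1) atTop atTop :=
      tendsto_atTop_add_const_right _ _ tendsto_natCast_atTop_atTop
    filter_upwards [h2.eventually h1] with T hT
    refine (le_abs_self _).trans (hT.trans_eq ?_)
    rw [id, Real.norm_of_nonneg (by positivity)]
  have hbig : ∀ᶠ T : ℕ in atTop, k * D / (ε / 2) ≤ (T : ℝ) :=
    tendsto_natCast_atTop_atTop.eventually_ge_atTop _
  filter_upwards [h, hlog, hbig, eventually_ge_atTop 1] with T hT hl hb h1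
  have hT1 : (1 : ℝ) ≤ T := by exact_mod_cast h1
  have hreg := regret_le_log_expertWeight (g := g) hD hη hηD T x y r k
  have hlogw : Real.log (expertWeight g η T x y r k) ≤ 3 * Real.log ((T : ℝ) + 1) := by
    refine (Real.log_le_log (expertWeight_pos hD hη hηD T x y r k) hT).trans_eq ?_
    rw [Real.log_pow]
    norm_num
  have hmin : ((min T k : ℕ) : ℝ) * (η k * D) ≤ k * (η k * D) :=
    mul_le_mul_of_nonneg_right (by exact_mod_cast min_le_right T k)
      (mul_nonneg (hη k).le hD0)
  rw [div_le_iff₀ (half_pos hε)] at hb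
  rw [one_div, inv_mul_le_iff₀ (by linarith)]
  refine le_of_mul_le_mul_left ?_ (hη k)
  have hb' := mul_le_mul_of_nonneg_left hb (hη k).le
  have hεη := mul_le_mul_of_nonneg_left hT1 (mul_pos hε (hη k)).le
  linarith

end Bounds

end Hedge

/-! ### The learning rule and its consistency. -/

section Rule

variable {X : Type u} {Y : Type v} [MeasurableSpace X] [MetricSpace Y] [MeasurableSpace Y]
  [BorelSpace Y] [SecondCountableTopology Y]

lemma measurable_extend_fin {Z S : Type*} [MeasurableSpace Z] [MeasurableSpace S] {t : ℕ}
    {a : S → Fin t → Z} (ha : Measurable a) {b : S → Z} (hb : Measurable b) :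
    Measurable fun (q : S) (s : ℕ) => if h : s < t then a q ⟨s, h⟩ else b q := by
  refine measurable_pi_lambda _ fun s => ?_
  by_cases h : s < t
  · simp only [dif_pos h]
    exact (measurable_pi_apply _).comp ha
  · simpa only [dif_neg h] using hb

lemma measurable_expertPlay_extend {g : ℕ → X → Y} (hg : ∀ i, Measurable (g i)) (η : ℕ → ℝ)
    (y₀ : Y) (t : ℕ) :
    Measurable fun p : (Fin t → X) × (Fin t → Y) × X × (ℕ → ℝ) =>
      expertPlay g η t (fun s => if h : s < t then p.1 ⟨s, h⟩ else p.2.2.1)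
        (fun s => if h : s < t then p.2.1 ⟨s, h⟩ else y₀) p.2.2.2 := by
  exact measurable_expertPlay_comp hg t
    (measurable_extend_fin measurable_fst measurable_snd.snd.fst)
    (measurable_extend_fin measurable_snd.fst measurable_const) measurable_snd.snd.snd

/-- The online learning rule that samples from the experts `g` with learning rates `η`. -/
noncomputable def expertRule (g : ℕ → X → Y) (hg : ∀ i, Measurable (g i)) (η : ℕ → ℝ) (y₀ : Y) :
    OnlineLearningRule X Y where
  Seed := ℕ → ℝ
  law := seedLaw
  predict t xs ys x r := expertPlay g η t (fun s => if h : s < t then xs ⟨s, h⟩ else x)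
    (fun s => if h : s < t then ys ⟨s, h⟩ else y₀) r
  measurable_predict := measurable_expertPlay_extend hg η y₀

/-- Play in round `t` reads points up to index `t` and responses below `t`, where the padded
sequences agree with the data; the filler `y₀` is never read. -/
lemma expertRule_predict (g : ℕ → X → Y) (hg : ∀ i, Measurable (g i)) (η : ℕ → ℝ) (y₀ : Y)
    (t : ℕ) (x : ℕ → X) (y : ℕ → Y) (r : ℕ → ℝ) :
    (expertRule g hg η y₀).predict t (fun s : Fin t => x s) (fun s : Fin t => y s) (x t) r =
      expertPlay g η t x y r := by
  simp only [expertRule]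
  refine expertPlay_congr (fun s hs => ?_) (fun s hs => by simp [hs])
  rcases hs.lt_or_eq with h | rfl
  · simp [h]
  · simp

/-- The excess over `f` splits into the regret to expert `k` and the excess of `g k` over `f`; the
latter is at most `ε` per round off the bad set and at most `D` on it. -/
lemma expertRule_excessLoss_nonpos {g : ℕ → X → Y} (hg : ∀ i, Measurable (g i)) {η : ℕ → ℝ}
    {y₀ : Y} {D : ℝ} (hD : ∀ a b : Y, dist a b ≤ D) {f : X → Y} {x : ℕ → X} {y : ℕ → Y}
    {r : ℕ → ℝ}
    (h : ∀ ε > 0, ∃ k, upperFrequency x {z | ε ≤ dist (g k z) (f z)} < ε ∧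
      ∀ᶠ T : ℕ in atTop, (1 / (T : ℝ)) * ∑ t ∈ Finset.range T,
        (dist (expertPlay g η t x y r) (y t) - dist (g k (x t)) (y t)) ≤ ε) :
    (expertRule g hg η y₀).excessLoss f x y r ≤ 0 := by
  have hD0 : 0 ≤ D := dist_nonneg.trans (hD y₀ y₀)
  simp only [OnlineLearningRule.excessLoss, expertRule_predict]
  have hlow : IsBoundedUnder (· ≥ ·) atTop fun T : ℕ => (1 / (T : ℝ)) * ∑ t ∈ Finset.range T,
      (dist (expertPlay g η t x y r) (y t) - dist (f (x t)) (y t)) := by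
    refine isBoundedUnder_of ⟨-D, fun T => ?_⟩
    have hs : ∑ t ∈ Finset.range T, -D ≤ ∑ t ∈ Finset.range T,
        (dist (expertPlay g η t x y r) (y t) - dist (f (x t)) (y t)) :=
      Finset.sum_le_sum fun t _ => (abs_le.1 (abs_dist_sub_dist_le hD _ _ _)).1
    rw [Finset.sum_const, Finset.card_range, nsmul_eq_mul] at hs
    rcases Nat.eq_zero_or_pos T with rfl | hT
    · simpa using hD0
    · have hT' : (0 : ℝ) < T := by exact_mod_cast hT
      rw [ge_iff_le, one_div, le_inv_mul_iff₀ hT']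
      exact hs
  refine le_of_forall_pos_le_add fun γ hγ => ?_
  -- Regret `ε`, closeness `ε` and bad set `D * ε` add up to `γ`.
  obtain ⟨k, hk, hreg⟩ := h (γ / (2 + D)) (by positivity)
  set ε := γ / (2 + D)
  have hε : 0 < ε := by positivity
  have hγε : γ = ε + (ε + D * ε) := by
    simp only [ε]
    field_simp
    ring
  refine limsup_le_of_le hlow.isCoboundedUnder_le ?_
  filter_upwards [hreg, eventually_lt_of_limsup_lt hk (isBoundedUnder_le_indicator_average x _),
    eventually_ge_atTop 1] with T hT hfreq hT1
  have hT0 : (0 : ℝ) < T := by exact_mod_cast hT1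
  set A := {z | ε ≤ dist (g k z) (f z)} with hA
  have hterm : ∀ z w, dist (g k z) w - dist (f z) w ≤
      ε + D * A.indicator (fun _ => (1 : ℝ)) z := by
    intro z w
    have h1 : dist (g k z) w - dist (f z) w ≤ dist (g k z) (f z) := by
      linarith [dist_triangle (g k z) (f z) w]
    by_cases hz : z ∈ A
    · simp only [Set.indicator_of_mem hz]
      linarith [hD (g k z) (f z)]
    · simp only [Set.indicator_of_notMem hz]
      have : dist (g k z) (f z) < ε := not_le.1 hz
      linarith
  have hsum : ∑ t ∈ Finset.range T, (dist (g k (x t)) (y t) - dist (f (x t)) (y t)) ≤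
      T * ε + D * ∑ t ∈ Finset.range T, A.indicator (fun _ => (1 : ℝ)) (x t) := by
    refine (Finset.sum_le_sum fun t _ => hterm (x t) (y t)).trans_eq ?_
    rw [Finset.sum_add_distrib, Finset.mul_sum]
    simp
  have havg : (1 / (T : ℝ)) * ∑ t ∈ Finset.range T,
      (dist (g k (x t)) (y t) - dist (f (x t)) (y t)) ≤ ε + D * ε := by
    calc _ ≤ (1 / (T : ℝ)) * (T * ε +
          D * ∑ t ∈ Finset.range T, A.indicator (fun _ => (1 : ℝ)) (x t)) :=
          mul_le_mul_of_nonneg_left hsum (by positivity)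
      _ = ε + D * ((1 / (T : ℝ)) *
          ∑ t ∈ Finset.range T, A.indicator (fun _ => (1 : ℝ)) (x t)) := by
          field_simp
      _ ≤ ε + D * ε := by gcongr
  have hsplit : ∑ t ∈ Finset.range T,
      (dist (expertPlay g η t x y r) (y t) - dist (f (x t)) (y t)) =
      ∑ t ∈ Finset.range T, (dist (expertPlay g η t x y r) (y t) - dist (g k (x t)) (y t)) +
      ∑ t ∈ Finset.range T, (dist (g k (x t)) (y t) - dist (f (x t)) (y t)) := by
    rw [← Finset.sum_add_distrib]
    exact Finset.sum_congr rfl fun t _ => by ring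
  rw [hsplit, mul_add, zero_add, hγε]
  exact add_le_add hT havg

/-- Along a fixed process, almost surely no expert's weight grows faster than cubically. -/
lemma ae_prod_eventually_expertWeight_le {g : ℕ → X → Y} (hg : ∀ i, Measurable (g i))
    {η : ℕ → ℝ} {D : ℝ} (hD : ∀ a b : Y, dist a b ≤ D) (hη : ∀ k, 0 < η k)
    (hηD : ∀ k, η k * D ≤ 1 / 2) {Ω : Type w} [MeasurableSpace Ω] {P : Measure Ω}
    {Xs : ℕ → Ω → X} {Ys : ℕ → Ω → Y} (hX : ∀ t, Measurable (Xs t)) (hY : ∀ t, Measurable (Ys t)) :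
    ∀ᵐ p ∂(P.prod seedLaw), ∀ k, ∀ᶠ T : ℕ in atTop,
      expertWeight g η T (fun t => Xs t p.1) (fun t => Ys t p.1) p.2 k ≤ ((T : ℝ) + 1) ^ 3 := by
  -- The seed is independent of the data, so the data sequence may be frozen.
  refine (Measure.ae_prod_iff_ae_ae ?_).2 (Eventually.of_forall fun ω =>
    ae_eventually_expertWeight_le hD hη hηD hg (fun t => Xs t ω) (fun t => Ys t ω))
  have hW : ∀ T k, Measurable fun p : Ω × (ℕ → ℝ) =>
      expertWeight g η T (fun t => Xs t p.1) (fun t => Ys t p.1) p.2 k := by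
    intro T k
    have hXm : Measurable fun (p : Ω × (ℕ → ℝ)) t => Xs t p.1 :=
      measurable_pi_lambda _ fun t => (hX t).comp measurable_fst
    have hYm : Measurable fun (p : Ω × (ℕ → ℝ)) t => Ys t p.1 :=
      measurable_pi_lambda _ fun t => (hY t).comp measurable_fst
    exact (measurable_pi_apply k).comp (measurable_expertWeight_comp hg T hXm hYm measurable_snd)
  simp only [eventually_atTop, Set.ofPred_forall, Set.ofPred_exists]
  exact MeasurableSet.iInter fun k => MeasurableSet.iUnion fun N => MeasurableSet.iInter fun T =>
    MeasurableSet.iInter fun _ => measurableSet_le (hW T k) measurable_const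

end Rule

theorem theorem1 {X : Type u} {Y : Type v}
    [TopologicalSpace X] [TopologicalSpace.MetrizableSpace X] [TopologicalSpace.SeparableSpace X]
    [MeasurableSpace X] [BorelSpace X] [Nonempty X]
    [MetricSpace Y] [BoundedSpace Y] [TopologicalSpace.SeparableSpace Y]
    [MeasurableSpace Y] [BorelSpace Y] [Nonempty Y] :
    ∃ f : OnlineLearningRule X Y,
      ∀ (Ω : Type w) [MeasurableSpace Ω] (P : Measure Ω) [IsProbabilityMeasure P]
        (Xs : ℕ → Ω → X) (Ys : ℕ → Ω → Y),
        (∀ t, Measurable (Xs t)) → (∀ t, Measurable (Ys t)) →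
        ContinuousSubmeasureCondition P Xs → f.StronglyConsistent P Xs Ys := by
  have : SecondCountableTopology Y := UniformSpace.secondCountable_of_separable Y
  have : SecondCountableTopology X := by
    let := TopologicalSpace.metrizableSpaceMetric X
    exact UniformSpace.secondCountable_of_separable X
  obtain ⟨g, hg, hdense⟩ := exists_dense_sequence (X := X) (Y := Y)
  obtain ⟨y₀⟩ := ‹Nonempty Y›
  set D : ℝ := Metric.diam (Set.univ : Set Y)
  have hD : ∀ a b : Y, dist a b ≤ D := fun a b =>
    Metric.dist_le_diam_of_mem BoundedSpace.bounded_univ (Set.mem_univ a) (Set.mem_univ b)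
  have hD0 : 0 ≤ D := Metric.diam_nonneg
  -- Expert `Nat.pair i j` is predictor `i` with a rate of order `1 / (j + 1)`; `D + 1` keeps the
  -- rate finite when `D = 0`.
  set G : ℕ → X → Y := fun k => g k.unpair.1
  set η : ℕ → ℝ := fun k => 1 / (2 * (D + 1) * (k.unpair.2 + 1)) with hηdef
  have hG : ∀ k, Measurable (G k) := fun k => hg _
  have hη : ∀ k, 0 < η k := fun k => by positivity
  have hηD : ∀ k, η k * D ≤ 1 / 2 := by
    intro k
    have hj : (0 : ℝ) ≤ k.unpair.2 := Nat.cast_nonneg _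
    rw [hηdef, div_mul_eq_mul_div, one_mul, div_le_div_iff₀ (by positivity) two_pos]
    nlinarith [mul_nonneg hD0 hj]
  refine ⟨expertRule G hG η y₀, fun Ω _ P _ Xs Ys hX hY hcond f hf => ?_⟩
  have hfreq : ∀ᵐ ω ∂P, ∀ n : ℕ, ∃ i, upperFrequency (fun t => Xs t ω)
      {x | 1 / ((n : ℝ) + 1) ≤ dist (g i x) (f x)} < 1 / ((n : ℝ) + 1) :=
    ae_all_iff.2 fun n => ae_exists_upperFrequency_lt hg hdense hX hcond hf (by positivity)
  have hfreq' : ∀ᵐ p ∂(P.prod seedLaw), ∀ n : ℕ, ∃ i, upperFrequency (fun t => Xs t p.1)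
      {x | 1 / ((n : ℝ) + 1) ≤ dist (g i x) (f x)} < 1 / ((n : ℝ) + 1) :=
    Measure.quasiMeasurePreserving_fst.ae hfreq
  have hweight := ae_prod_eventually_expertWeight_le (P := P) hG hD hη hηD hX hY
  change ∀ᵐ p ∂(P.prod seedLaw), _
  filter_upwards [hfreq', hweight] with p hp hw
  refine expertRule_excessLoss_nonpos hG hD fun ε hε => ?_
  obtain ⟨n, hn⟩ := exists_nat_one_div_lt hε
  obtain ⟨i, hi⟩ := hp n
  -- Makes the residual regret `2 * η * D ^ 2 = D ^ 2 / ((D + 1) * (j + 1))` at most `ε / 2`.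
  obtain ⟨j, hj⟩ := exists_nat_gt (D / (ε / 2))
  refine ⟨Nat.pair i j, ?_, ?_⟩
  · simp only [G, Nat.unpair_pair]
    refine lt_of_le_of_lt (upperFrequency_mono _ fun x hx => ?_) (hi.trans hn)
    exact hn.le.trans hx
  · filter_upwards [eventually_average_regret_le hD hη hηD (hw (Nat.pair i j)) (half_pos hε)]
      with T hT
    refine hT.trans ?_
    have hbound : 2 * η (Nat.pair i j) * D ^ 2 ≤ ε / 2 := by
      simp only [hηdef, Nat.unpair_pair]
      have hj0 : (0 : ℝ) ≤ j := Nat.cast_nonneg _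
      rw [div_lt_iff₀ (half_pos hε)] at hj
      have : 2 * (1 / (2 * (D + 1) * ((j : ℝ) + 1))) * D ^ 2 =
          D * D / ((D + 1) * ((j : ℝ) + 1)) := by
        field_simp
      rw [this, div_le_iff₀ (by positivity)]
      have h1 := mul_le_mul_of_nonneg_left hj.le hD0
      have h2 : 0 ≤ ε * D := by positivity
      have h3 : 0 ≤ ε * j := by positivity
      linarith
    linarith
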